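/- Conventions. Let $A_0,A_1$ be quasi-normed spaces (over $\mathbb R$ or $\mathbb C$) forming a compatible couple, i.e. both are continuously embedded in one Hausdorff topological vector space. For $f\in A_0+A_1$ and $t>0$ put $$K(t,f)=K(t,f;A_0,A_1)=\inf\{\|f_0\|_{A_0}+t\|f_1\|_{A_1}:\ f=f_0+f_1,\ f_0\in A_0,\ f_1\in A_1\},$$ with $\inf\emptyset=\infty$ when $K(\cdot,f;X_0,X_1)$ is formed for $f\notin X_0+X_1$. The couple is $K$-surjective if for every quasi-concave $\phi:(0,\infty)\to(0,\infty)$ (i.e. $\phi(t)$ and $t\phi(1/t)$ are non-decreasing) there are $f\in A_0+A_1$ and constants $c,C>0$ with $c\,\phi(t)\le K(t,f)\le C\,\phi(t)$ for all $t>0$. A Lebesgue measurable $b:(0,\infty)\to(0,\infty)$ is slowly varying, $b\in SV$, if for every $\varepsilon>0$ there are positive functions $g_\varepsilon$ (non-decreasing) and $g_{-\varepsilon}$ (non-increasing) on $(0,\infty)$ such that each of the quotients $t^{\varepsilon}b(t)/g_\varepsilon(t)$ and $t^{-\varepsilon}b(t)/g_{-\varepsilon}(t)$ lies between two positive constants for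 all $t>0$. For $0<q\le\infty$, $\bar A_{\theta,q;b}$ is the space of all $f\in A_0+A_1$ with finite quasi-norm $\|f\|_{\bar A_{\theta,q;b}}=\|u^{-\theta-1/q}b(u)K(u,f)\|_{L^q(0,\infty)}$ (with $1/q=0$ for $q=\infty$). Theorem. Let $0<\theta<1$, let $0<q_0,q_1\le\infty$ with $q_0\ne q_1$, let $b_0,b_1\in SV$, and let $(A_0,A_1)$ be $K$-surjective. Then there is no positive function $w$ on $(0,\infty)$ for which there exists a constant $c>0$ such that, for all $f\in A_0+A_1$ and all $t>0$, $$K\big(w(t),f;\bar A_{\theta,q_0;b_0},\bar A_{\theta,q_1;b_1}\big)\ \ge\ c\left(\big\|u^{-\theta-1/q_0}b_0(u)K(u,f)\big\|_{L^{q_0}(0,t)}+w(t)\,\big\|u^{-\theta-1/q_1}b_1(u)K(u,f)\big\|_{L^{q_1}(t,\infty)}\right).$$ -/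

import Mathlib

open MeasureTheory Set
open scoped ENNReal

namespace KInterpolation

/-- A quasi-normed space over `𝕜` which is continuously embedded in the topological vector space
`V` (it is identified with its image, a subspace of `V` carrying its own quasi-norm). A compatible
couple is a pair of these in one and the same Hausdorff topological vector space `V`. -/
structure QuasiNormedSubspace (𝕜 V : Type*) [RCLike 𝕜] [AddCommGroup V] [Module 𝕜 V]
    [TopologicalSpace V] where
  carrier : Submodule 𝕜 V
  qnorm : carrier → ℝ
  qnorm_nonneg : ∀ x, 0 ≤ qnorm x
  qnorm_eq_zero_iff : ∀ x, qnorm x = 0 ↔ x = 0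
  qnorm_smul : ∀ (a : 𝕜) (x : carrier), qnorm (a • x) = ‖a‖ * qnorm x
  qnorm_add_le : ∃ C : ℝ, ∀ x y, qnorm (x + y) ≤ C * (qnorm x + qnorm y)
  continuous_incl : ∀ U ∈ nhds (0 : V), ∃ δ : ℝ, 0 < δ ∧ ∀ x, qnorm x < δ → (x : V) ∈ U

open Classical in
/-- The quasi-norm of `A`, extended by `∞` to the elements of `V` outside `A`. -/
noncomputable def QuasiNormedSubspace.extNorm {𝕜 V : Type*} [RCLike 𝕜] [AddCommGroup V]
    [Module 𝕜 V] [TopologicalSpace V] (A : QuasiNormedSubspace 𝕜 V) (f : V) : ℝ≥0∞ :=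
  if h : f ∈ A.carrier then ENNReal.ofReal (A.qnorm ⟨f, h⟩) else ∞

/-- The `K`-functional `K(t, f) = inf {N₀ f₀ + t N₁ f₁ : f = f₀ + f₁}`, `t > 0`, of two spaces given
by their extended quasi-norms `N₀`, `N₁`, which are `∞` outside the spaces: decompositions
with `f₀` or `f₁` outside the respective space contribute `∞`, so that the infimum is the one
over the `f₀`, `f₁` in the spaces. It is `∞` if `f` has no such decomposition. -/
noncomputable def K {V : Type*} [AddCommGroup V] (N₀ N₁ : V → ℝ≥0∞) (t : ℝ) (f : V) : ℝ≥0∞ :=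
  ⨅ (f₀ : V) (f₁ : V) (_ : f = f₀ + f₁), N₀ f₀ + ENNReal.ofReal t * N₁ f₁

/-- `F ≈ G` on `(0, ∞)` for real functions. -/
def Approx (F G : ℝ → ℝ) : Prop :=
  ∃ c : ℝ, 0 < c ∧ ∃ C : ℝ, 0 < C ∧ ∀ t : ℝ, 0 < t → c * G t ≤ F t ∧ F t ≤ C * G t

/-- The class `SV` of slowly varying functions on `(0, ∞)` (values off `(0, ∞)` are irrelevant). -/
structure SlowlyVarying (b : ℝ → ℝ) : Prop where
  aemeasurable : AEMeasurable b (volume.restrict (Ioi 0))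
  pos : ∀ t : ℝ, 0 < t → 0 < b t
  exists_monotone : ∀ ε : ℝ, 0 < ε → ∃ g : ℝ → ℝ, (∀ t : ℝ, 0 < t → 0 < g t) ∧ MonotoneOn g (Ioi 0) ∧
    Approx (fun t => t ^ ε * b t) g
  exists_antitone : ∀ ε : ℝ, 0 < ε → ∃ g : ℝ → ℝ, (∀ t : ℝ, 0 < t → 0 < g t) ∧ AntitoneOn g (Ioi 0) ∧
    Approx (fun t => t ^ (-ε) * b t) g

/-- Quasi-concave functions `φ : (0, ∞) → (0, ∞)`. -/
structure QuasiConcave (φ : ℝ → ℝ) : Prop where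
  pos : ∀ t : ℝ, 0 < t → 0 < φ t
  monotone : MonotoneOn φ (Ioi 0)
  monotone_conj : MonotoneOn (fun t => t * φ (1 / t)) (Ioi 0)

/-- `‖u^(-θ - 1/q) b(u) k(u)‖` in `L^q(S)`, for a function `k` with values in `[0, ∞]`;
`1/q` is `0` for `q = ∞`. -/
noncomputable def weightedNorm (θ : ℝ) (q : ℝ≥0∞) (b : ℝ → ℝ) (k : ℝ → ℝ≥0∞) (S : Set ℝ) : ℝ≥0∞ :=
  eLpNorm (fun u => ENNReal.ofReal (u ^ (-θ - 1 / q.toReal) * b u) * k u) q (volume.restrict S)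

section Couple

variable {𝕜 V : Type*} [RCLike 𝕜] [AddCommGroup V] [Module 𝕜 V] [TopologicalSpace V]

/-- `K(t, f; A₀, A₁)`. -/
noncomputable def coupleK (A₀ A₁ : QuasiNormedSubspace 𝕜 V) (t : ℝ) (f : V) : ℝ≥0∞ :=
  K A₀.extNorm A₁.extNorm t f

/-- The extended quasi-norm of the `K`-interpolation space `(A₀, A₁)_{θ,q;b}`; the space consists
of the `f` for which it is finite (these lie in `A₀ + A₁`, as `K(t, f; A₀, A₁) = ∞` otherwise). -/
noncomputable def interpNorm (A₀ A₁ : QuasiNormedSubspace 𝕜 V) (θ : ℝ) (q : ℝ≥0∞) (b : ℝ → ℝ)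
    (f : V) : ℝ≥0∞ :=
  weightedNorm θ q b (fun u => coupleK A₀ A₁ u f) (Ioi 0)

/-- `K`-surjective couples: every quasi-concave function is equivalent to some `K(·, f)`,
`f ∈ A₀ + A₁`. -/
def KSurjective (A₀ A₁ : QuasiNormedSubspace 𝕜 V) : Prop :=
  ∀ φ : ℝ → ℝ, QuasiConcave φ → ∃ f ∈ A₀.carrier ⊔ A₁.carrier,
    ∃ c : ℝ, 0 < c ∧ ∃ C : ℝ, 0 < C ∧ ∀ t : ℝ, 0 < t →
      ENNReal.ofReal (c * φ t) ≤ coupleK A₀ A₁ t f ∧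
      coupleK A₀ A₁ t f ≤ ENNReal.ofReal (C * φ t)

end Couple

end KInterpolation

/-!
Testing the estimate on the decompositions `f = f + 0` and `f = 0 + f` turns it into two weighted
embeddings: `w t` times the `(q₁, b₁)`-norm over `(t, ∞)` is bounded by the `(q₀, b₀)`-norm, and the
`(q₀, b₀)`-norm over `(0, t)` is bounded by `w t` times the `(q₁, b₁)`-norm. Each `f` could a priori
lose its own constant when `K(·, f)` is replaced by an equivalent quasi-concave function; a gliding
hump, for which the class of quasi-concave functions is large enough, makes the constants uniform.

The embeddings are then tested on quasi-concave `φ` for which `u ^ (-θ) * b u * φ u` is comparable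
to `1` on a window `(a, d)` and decays like a power outside it. With respect to `du / u` the
`L^q`-norm of such a bump is of order `L ^ (1 / q)`, where `L = log (d / a)`. Windows with `L = 1`
show that `w` and `ρ = b₀ / b₁` are comparable and almost increasing. Long windows then give
`ρ d ≥ c * L ^ |1 / q₀ - 1 / q₁| * ρ a`. As `q₀ ≠ q₁`, for some fixed `L` this doubles `ρ` at every
dilation by `exp L`, so `ρ` grows at least like a positive power, which a slowly varying function
does not.
-/

namespace KInterpolation

open scoped NNReal

section LpNorm

variable {α : Type*} {mα : MeasurableSpace α} {μ : Measure α}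

theorem lintegral_iSup_rpow_le_tsum {ι : Type*} [Countable ι] {f : ι → α → ℝ≥0∞}
    (hf : ∀ i, AEMeasurable (f i) μ) {p : ℝ} (hp : 0 < p) :
    ∫⁻ x, (⨆ i, f i x) ^ p ∂μ ≤ ∑' i, ∫⁻ x, f i x ^ p ∂μ := by
  rw [← lintegral_tsum fun i => (hf i).pow_const p]
  refine lintegral_mono fun x => ?_
  rw [← ENNReal.le_rpow_inv_iff hp]
  refine iSup_le fun i => ?_
  rw [ENNReal.le_rpow_inv_iff hp]
  exact ENNReal.le_tsum (f := fun i => f i x ^ p) i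

theorem eLpNormEssSup_iSup_le {ι : Type*} [Countable ι] (f : ι → α → ℝ≥0∞) :
    eLpNormEssSup (fun x => ⨆ i, f i x) μ ≤ ⨆ i, eLpNormEssSup (f i) μ := by
  refine essSup_le_of_ae_le _ ?_
  filter_upwards [ae_all_iff.2 fun i => ae_le_eLpNormEssSup (f := f i) (μ := μ)] with x hx
  exact iSup_mono hx

theorem eLpNorm_iSup_lt_top_of_le_geometric {q : ℝ≥0∞} {f : ℕ → α → ℝ≥0∞}
    (hf : ∀ n, AEMeasurable (f n) μ) (h : ∀ n, eLpNorm (f n) q μ ≤ 2⁻¹ ^ n) :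
    eLpNorm (fun x => ⨆ n, f n x) q μ < ∞ := by
  rcases eq_or_ne q 0 with rfl | hq
  · simp
  rcases eq_or_ne q ∞ with rfl | hq'
  · simp only [eLpNorm_exponent_top] at h ⊢
    refine (eLpNormEssSup_iSup_le f).trans_lt (lt_of_le_of_lt ?_ ENNReal.one_lt_top)
    exact iSup_le fun n => (h n).trans (pow_le_one₀ zero_le (by simp))
  have hp : 0 < q.toReal := ENNReal.toReal_pos hq hq'
  have hn (n : ℕ) : ∫⁻ x, f n x ^ q.toReal ∂μ ≤ (2⁻¹ ^ q.toReal) ^ n := by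
    have := h n
    rw [eLpNorm_eq_lintegral_rpow_enorm_toReal hq hq', one_div, ENNReal.rpow_inv_le_iff hp] at this
    simpa only [enorm_eq_self, ← ENNReal.rpow_natCast, ← ENNReal.rpow_mul,
      mul_comm (n : ℝ)] using this
  rw [eLpNorm_lt_top_iff_lintegral_rpow_enorm_lt_top hq hq']
  calc ∫⁻ x, ‖⨆ n, f n x‖ₑ ^ q.toReal ∂μ
      ≤ ∑' n, ∫⁻ x, f n x ^ q.toReal ∂μ := lintegral_iSup_rpow_le_tsum hf hp
    _ ≤ ∑' n, (2⁻¹ ^ q.toReal) ^ n := ENNReal.tsum_le_tsum hn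
    _ < ∞ := by
      rw [ENNReal.tsum_geometric, ENNReal.inv_lt_top]
      exact tsub_pos_of_lt (ENNReal.rpow_lt_one (by simp) hp)

end LpNorm

section WeightedNorm

variable {θ : ℝ} {q : ℝ≥0∞} {b : ℝ → ℝ} {S : Set ℝ}

theorem weightedNorm_mono_set (k : ℝ → ℝ≥0∞) {T : Set ℝ} (h : S ⊆ T) :
    weightedNorm θ q b k S ≤ weightedNorm θ q b k T :=
  eLpNorm_mono_measure _ (Measure.restrict_mono h le_rfl)

theorem weightedNorm_le_mul (hS : MeasurableSet S) {k k' : ℝ → ℝ≥0∞} {c : ℝ≥0}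
    (h : ∀ u ∈ S, k u ≤ c * k' u) :
    weightedNorm θ q b k S ≤ c * weightedNorm θ q b k' S := by
  refine eLpNorm_le_nnreal_smul_eLpNorm_of_ae_le_mul'
    (ae_restrict_of_forall_mem hS fun u hu => ?_) q
  simp only [enorm_eq_self]
  rw [mul_left_comm]
  gcongr
  exact h u hu

theorem weightedNorm_one_Ioi_ne_zero (hb : AEMeasurable b (volume.restrict (Ioi 0)))
    (hb_pos : ∀ u, 0 < u → 0 < b u) (hq : q ≠ 0) {a : ℝ} (ha : 0 ≤ a) :
    weightedNorm θ q b 1 (Ioi a) ≠ 0 := by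
  have hb_a : AEMeasurable b (volume.restrict (Ioi a)) :=
    hb.mono_measure (Measure.restrict_mono (Ioi_subset_Ioi ha) le_rfl)
  have hweight : AEMeasurable
      (fun u => ENNReal.ofReal (u ^ (-θ - 1 / q.toReal) * b u) * (1 : ℝ → ℝ≥0∞) u)
      (volume.restrict (Ioi a)) :=
    ((measurable_id.pow_const _).aemeasurable.mul hb_a).ennreal_ofReal.mul aemeasurable_const
  rw [weightedNorm, Ne, eLpNorm_eq_zero_iff hweight.aestronglyMeasurable hq]
  intro hzero
  have hfalse : ∀ᵐ _ ∂(volume.restrict (Ioi a)), False := by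
    filter_upwards [hzero, ae_restrict_mem measurableSet_Ioi] with u hu hau
    have hu₀ : 0 < u := ha.trans_lt hau
    have := mul_pos (Real.rpow_pos_of_pos hu₀ (-θ - 1 / q.toReal)) (hb_pos u hu₀)
    simp only [Pi.one_apply, mul_one, Pi.zero_apply, ENNReal.ofReal_eq_zero] at hu
    exact this.not_ge hu
  rw [Filter.eventually_false_iff_eq_bot, ae_eq_bot, Measure.restrict_eq_zero] at hfalse
  simp at hfalse

/-- Monotonicity and positive homogeneity, in one inequality, of a functional of the values on
`(0, ∞)` of a nonnegative function. The uniform boundedness principle applies to families of such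
functionals. -/
def MonotoneHomogeneous (T : (ℝ → ℝ≥0∞) → ℝ≥0∞) : Prop :=
  ∀ ⦃k k' : ℝ → ℝ≥0∞⦄ ⦃c : ℝ≥0⦄, (∀ u, 0 < u → k u ≤ c * k' u) → T k ≤ c * T k'

theorem monotoneHomogeneous_weightedNorm (θ : ℝ) (q : ℝ≥0∞) (b : ℝ → ℝ) (hS : MeasurableSet S)
    (hS₀ : S ⊆ Ioi 0) : MonotoneHomogeneous (weightedNorm θ q b · S) :=
  fun _ _ _ h => weightedNorm_le_mul hS fun u hu => h u (hS₀ hu)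

theorem MonotoneHomogeneous.const_mul {T : (ℝ → ℝ≥0∞) → ℝ≥0∞} (hT : MonotoneHomogeneous T)
    (r : ℝ≥0∞) : MonotoneHomogeneous fun k => r * T k := fun k k' c h => by
  calc r * T k ≤ r * (c * T k') := by gcongr; exact hT h
    _ = c * (r * T k') := mul_left_comm _ _ _

end WeightedNorm

section QuasiConcave

theorem QuasiConcave.const_mul {φ : ℝ → ℝ} (h : QuasiConcave φ) {c : ℝ} (hc : 0 < c) :
    QuasiConcave (fun u => c * φ u) where
  pos t ht := mul_pos hc (h.pos t ht)
  monotone s hs t ht hst := mul_le_mul_of_nonneg_left (h.monotone hs ht hst) hc.le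
  monotone_conj s hs t ht hst := by
    simpa only [mul_left_comm _ c] using
      mul_le_mul_of_nonneg_left (h.monotone_conj hs ht hst) hc.le

theorem QuasiConcave.iSup {ι : Type*} [Nonempty ι] {φ : ι → ℝ → ℝ} (h : ∀ i, QuasiConcave (φ i))
    (hbdd : ∀ u, 0 < u → BddAbove (range fun i => φ i u)) :
    QuasiConcave (fun u => ⨆ i, φ i u) where
  pos t ht := ((h (Classical.arbitrary ι)).pos t ht).trans_le (le_ciSup (hbdd t ht) _)
  monotone s hs t ht hst := ciSup_mono (hbdd t ht) fun i => (h i).monotone hs ht hst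
  monotone_conj s hs t ht hst := by
    have hs₀ : 0 < s := hs
    have ht₀ : 0 < t := ht
    simp only [Real.mul_iSup_of_nonneg hs₀.le, Real.mul_iSup_of_nonneg ht₀.le]
    refine ciSup_mono ?_ fun i => (h i).monotone_conj hs ht hst
    obtain ⟨M, hM⟩ := hbdd (1 / t) (one_div_pos.2 ht₀)
    refine ⟨t * M, forall_mem_range.2 fun i => ?_⟩
    exact mul_le_mul_of_nonneg_left (hM (mem_range_self i)) ht₀.le

theorem quasiConcave_min_one_div {s : ℝ} (hs : 0 < s) :
    QuasiConcave (fun u => min 1 (u / s)) where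
  pos t ht := lt_min one_pos (div_pos ht hs)
  monotone u _ v _ huv := min_le_min le_rfl (by gcongr)
  monotone_conj u hu v hv huv := by
    have mul_min (x : ℝ) (hx : 0 < x) : x * min 1 (1 / x / s) = min x (1 / s) := by
      rw [mul_min_of_nonneg _ _ hx.le, mul_one]
      congr 1
      field_simp
    simp only [mul_min u hu, mul_min v hv]
    exact min_le_min huv le_rfl

end QuasiConcave

section UniformBoundedness

variable {θ : ℝ} {q : ℝ≥0∞} {b : ℝ → ℝ}

theorem QuasiConcave.ofReal_mul_weightedNorm_one_le {φ : ℝ → ℝ} (hφ : QuasiConcave φ) {u : ℝ}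
    (hu : 0 < u) :
    ENNReal.ofReal (φ u) * weightedNorm θ q b 1 (Ioi u) ≤
      weightedNorm θ q b (ENNReal.ofReal ∘ φ) (Ioi 0) := by
  have hφu : ENNReal.ofReal (φ u) ≠ 0 := (ENNReal.ofReal_pos.2 (hφ.pos u hu)).ne'
  have hφu' : (φ u).toNNReal ≠ 0 := (Real.toNNReal_pos.2 (hφ.pos u hu)).ne'
  refine le_trans ?_ (weightedNorm_mono_set _ (Ioi_subset_Ioi hu.le))
  rw [ENNReal.mul_le_iff_le_inv hφu ENNReal.ofReal_ne_top, ENNReal.ofReal,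
    ← ENNReal.coe_inv hφu']
  refine weightedNorm_le_mul measurableSet_Ioi fun v hv => ?_
  rw [ENNReal.coe_inv hφu']
  change 1 ≤ (ENNReal.ofReal (φ u))⁻¹ * ENNReal.ofReal (φ v)
  rw [← ENNReal.mul_le_iff_le_inv hφu ENNReal.ofReal_ne_top, mul_one]
  exact ENNReal.ofReal_le_ofReal (hφ.monotone hu (hu.trans hv) (le_of_lt hv))

theorem QuasiConcave.weightedNorm_ne_zero (hb : AEMeasurable b (volume.restrict (Ioi 0)))
    (hb_pos : ∀ u, 0 < u → 0 < b u) (hq : q ≠ 0) {φ : ℝ → ℝ} (hφ : QuasiConcave φ) :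
    weightedNorm θ q b (ENNReal.ofReal ∘ φ) (Ioi 0) ≠ 0 := by
  refine ne_bot_of_le_ne_bot ?_ (hφ.ofReal_mul_weightedNorm_one_le one_pos)
  exact mul_ne_zero (ENNReal.ofReal_pos.2 (hφ.pos 1 one_pos)).ne'
    (weightedNorm_one_Ioi_ne_zero hb hb_pos hq zero_le_one)

theorem QuasiConcave.aemeasurable_ofReal {φ : ℝ → ℝ} (hφ : QuasiConcave φ) :
    AEMeasurable (ENNReal.ofReal ∘ φ) (volume.restrict (Ioi 0)) :=
  (aemeasurable_restrict_of_monotoneOn measurableSet_Ioi hφ.monotone).ennreal_ofReal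

theorem exists_quasiConcave_ge_of_weightedNorm_le_geometric
    (hb : AEMeasurable b (volume.restrict (Ioi 0))) (hb_pos : ∀ u, 0 < u → 0 < b u) (hq : q ≠ 0)
    {φ : ℕ → ℝ → ℝ} (hφ : ∀ n, QuasiConcave (φ n))
    (hnorm : ∀ n, weightedNorm θ q b (ENNReal.ofReal ∘ φ n) (Ioi 0) ≤ 2⁻¹ ^ n) :
    ∃ Φ, QuasiConcave Φ ∧ (∀ n u, 0 < u → φ n u ≤ Φ u) ∧
      weightedNorm θ q b (ENNReal.ofReal ∘ Φ) (Ioi 0) < ∞ := by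
  have hbdd (u : ℝ) (hu : 0 < u) : BddAbove (range fun n => φ n u) := by
    have hone := weightedNorm_one_Ioi_ne_zero (θ := θ) hb hb_pos hq hu.le
    refine ⟨(weightedNorm θ q b 1 (Ioi u))⁻¹.toReal, forall_mem_range.2 fun n => ?_⟩
    rw [← ENNReal.ofReal_le_iff_le_toReal (ENNReal.inv_ne_top.2 hone)]
    refine ENNReal.le_inv_iff_mul_le.2 ?_
    exact ((hφ n).ofReal_mul_weightedNorm_one_le hu).trans
      ((hnorm n).trans (pow_le_one₀ zero_le (by simp)))
  refine ⟨fun u => ⨆ n, φ n u, .iSup hφ hbdd, fun n u hu => le_ciSup (hbdd u hu) n, ?_⟩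
  have hweight : AEMeasurable (fun u => ENNReal.ofReal (u ^ (-θ - 1 / q.toReal) * b u))
      (volume.restrict (Ioi 0)) :=
    ((measurable_id.pow_const _).aemeasurable.mul hb).ennreal_ofReal
  refine lt_of_le_of_lt (eLpNorm_mono_enorm_ae (ae_restrict_of_forall_mem measurableSet_Ioi
    fun u hu => ?_)) (eLpNorm_iSup_lt_top_of_le_geometric
      (fun n => hweight.mul (hφ n).aemeasurable_ofReal) hnorm)
  simp only [enorm_eq_self, Function.comp_apply, Pi.mul_apply, ← ENNReal.mul_iSup]
  gcongr
  exact (ENNReal.ofReal_mono.map_ciSup_of_continuousAt ENNReal.continuous_ofReal.continuousAt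
    (hbdd u hu)).le

theorem exists_quasiConcave_forall_le_two_pow_mul
    (hb : AEMeasurable b (volume.restrict (Ioi 0))) (hb_pos : ∀ u, 0 < u → 0 < b u) (hq : q ≠ 0)
    {φ : ℕ → ℝ → ℝ} (hφ : ∀ n, QuasiConcave (φ n)) {N : ℕ → ℝ≥0}
    (hN : ∀ n, weightedNorm θ q b (ENNReal.ofReal ∘ φ n) (Ioi 0) = N n) :
    ∃ Φ, QuasiConcave Φ ∧ weightedNorm θ q b (ENNReal.ofReal ∘ Φ) (Ioi 0) < ∞ ∧
      ∀ n u, 0 < u → φ n u ≤ (2 ^ n * N n : ℝ≥0) * Φ u := by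
  have hN₀ (n : ℕ) : N n ≠ 0 := fun h =>
    (hφ n).weightedNorm_ne_zero (θ := θ) hb hb_pos hq (by simp [hN, h])
  have hr (n : ℕ) : 0 < (2 ^ n * N n)⁻¹ := by
    have := pos_iff_ne_zero.2 (hN₀ n)
    positivity
  have hnorm (n : ℕ) : weightedNorm θ q b
      (ENNReal.ofReal ∘ fun u => ((2 ^ n * N n)⁻¹ : ℝ≥0) * φ n u) (Ioi 0) ≤ 2⁻¹ ^ n := by
    refine (weightedNorm_le_mul measurableSet_Ioi (c := (2 ^ n * N n)⁻¹)
      (k' := ENNReal.ofReal ∘ φ n) fun u _ => ?_).trans_eq ?_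
    · rw [Function.comp_apply, ENNReal.ofReal_mul (NNReal.coe_nonneg _), ENNReal.ofReal_coe_nnreal]
      rfl
    · rw [hN, ← ENNReal.coe_mul, mul_inv, mul_assoc, inv_mul_cancel₀ (hN₀ n), mul_one]
      push_cast
      simp [ENNReal.inv_pow]
  obtain ⟨Φ, hΦ, hle, hfin⟩ := exists_quasiConcave_ge_of_weightedNorm_le_geometric hb hb_pos hq
    (fun n => (hφ n).const_mul (NNReal.coe_pos.2 (hr n))) hnorm
  refine ⟨Φ, hΦ, hfin, fun n u hu => ?_⟩
  have := hle n u hu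
  rwa [NNReal.coe_inv, inv_mul_le_iff₀ (NNReal.coe_pos.2 (inv_pos.1 (hr n)))] at this

theorem exists_forall_quasiConcave_le (hb : AEMeasurable b (volume.restrict (Ioi 0)))
    (hb_pos : ∀ u, 0 < u → 0 < b u) (hq : q ≠ 0) {ι : Type*} {T : ι → (ℝ → ℝ≥0∞) → ℝ≥0∞}
    (hT : ∀ i, MonotoneHomogeneous (T i))
    (hbdd : ∀ φ, QuasiConcave φ → weightedNorm θ q b (ENNReal.ofReal ∘ φ) (Ioi 0) < ∞ →
      ∃ C : ℝ≥0, ∀ i, T i (ENNReal.ofReal ∘ φ) ≤ C) :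
    ∃ C : ℝ≥0, ∀ φ, QuasiConcave φ → ∀ i,
      T i (ENNReal.ofReal ∘ φ) ≤ C * weightedNorm θ q b (ENNReal.ofReal ∘ φ) (Ioi 0) := by
  -- Counterexamples with constants `4 ^ n`, scaled to norm `2 ^ (-n)`, have a supremum `Φ` of
  -- finite norm on which the functionals are unbounded.
  by_contra! hunbdd
  choose φ hφ i hlt using fun n : ℕ => hunbdd (4 ^ n)
  have hfin (n : ℕ) : weightedNorm θ q b (ENNReal.ofReal ∘ φ n) (Ioi 0) ≠ ∞ := fun h => by
    simpa [h, ENNReal.mul_top] using hlt n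
  lift (fun n => weightedNorm θ q b (ENNReal.ofReal ∘ φ n) (Ioi 0)) to ℕ → ℝ≥0 using hfin
    with N hN
  obtain ⟨Φ, hΦ, hΦfin, hle⟩ :=
    exists_quasiConcave_forall_le_two_pow_mul hb hb_pos hq hφ fun n => (congr_fun hN n).symm
  obtain ⟨C, hC⟩ := hbdd Φ hΦ hΦfin
  have hpow (n : ℕ) : (2 : ℝ≥0) ^ n < C := by
    have hTn : T (i n) (ENNReal.ofReal ∘ φ n) ≤ (2 ^ n * N n : ℝ≥0) * C := by
      refine (hT (i n) fun u hu => ?_).trans (mul_le_mul_right (hC (i n)) _)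
      rw [Function.comp_apply, Function.comp_apply, ← ENNReal.ofReal_coe_nnreal,
        ← ENNReal.ofReal_mul (NNReal.coe_nonneg _)]
      exact ENNReal.ofReal_le_ofReal (hle n u hu)
    have hlt_n := (hlt n).trans_le hTn
    rw [← congr_fun hN n, ← ENNReal.coe_mul, ← ENNReal.coe_mul, ENNReal.coe_lt_coe] at hlt_n
    refine lt_of_mul_lt_mul_left' (a := 2 ^ n * N n) (lt_of_eq_of_lt ?_ hlt_n)
    rw [mul_right_comm, ← mul_pow]
    norm_num
  obtain ⟨n, hn⟩ := pow_unbounded_of_one_lt C one_lt_two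
  exact (hpow n).not_gt hn

end UniformBoundedness

section LogMeasure

/-- The dilation invariant measure `du / u` on `(0, ∞)`, extended by zero: its density
`ENNReal.ofReal u⁻¹` vanishes on `(-∞, 0]`. -/
noncomputable def logMeasure : Measure ℝ :=
  volume.withDensity fun u => ENNReal.ofReal u⁻¹

theorem setLIntegral_logMeasure {S : Set ℝ} (hS : MeasurableSet S) (f : ℝ → ℝ≥0∞) :
    ∫⁻ u in S, f u ∂logMeasure = ∫⁻ u in S, ENNReal.ofReal u⁻¹ * f u :=
  setLIntegral_withDensity_eq_setLIntegral_mul_non_measurable _ measurable_inv.ennreal_ofReal f hS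
    (Filter.Eventually.of_forall fun _ => ENNReal.ofReal_lt_top)

theorem eLpNormEssSup_restrict_logMeasure {S : Set ℝ} (hS : MeasurableSet S) (hS₀ : S ⊆ Ioi 0)
    (f : ℝ → ℝ≥0∞) :
    eLpNormEssSup f (logMeasure.restrict S) = eLpNormEssSup f (volume.restrict S) := by
  rw [logMeasure, restrict_withDensity hS]
  refine (eLpNormEssSup_mono_measure f (withDensity_absolutelyContinuous _ _)).antisymm
    (eLpNormEssSup_mono_measure f (withDensity_absolutelyContinuous'
      measurable_inv.ennreal_ofReal.aemeasurable (ae_restrict_of_forall_mem hS fun u hu => ?_)))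
  exact (ENNReal.ofReal_pos.2 (inv_pos.2 (hS₀ hu))).ne'

theorem weightedNorm_eq_eLpNorm_logMeasure (θ : ℝ) (q : ℝ≥0∞) (b : ℝ → ℝ) (k : ℝ → ℝ≥0∞)
    {S : Set ℝ} (hS : MeasurableSet S) (hS₀ : S ⊆ Ioi 0) :
    weightedNorm θ q b k S =
      eLpNorm (fun u => ENNReal.ofReal (u ^ (-θ) * b u) * k u) q (logMeasure.restrict S) := by
  rcases eq_or_ne q 0 with rfl | hq
  · simp [weightedNorm]
  rcases eq_or_ne q ∞ with rfl | hq'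
  · simp [weightedNorm, eLpNormEssSup_restrict_logMeasure hS hS₀]
  have hp : 0 < q.toReal := ENNReal.toReal_pos hq hq'
  rw [weightedNorm, eLpNorm_eq_lintegral_rpow_enorm_toReal hq hq',
    eLpNorm_eq_lintegral_rpow_enorm_toReal hq hq', setLIntegral_logMeasure hS]
  congr 1
  refine setLIntegral_congr_fun hS fun u hu => ?_
  have hu₀ : 0 < u := hS₀ hu
  have hsplit : u ^ (-θ - 1 / q.toReal) * b u = u⁻¹ ^ q.toReal⁻¹ * (u ^ (-θ) * b u) := by
    rw [sub_eq_neg_add, Real.rpow_add hu₀, Real.rpow_neg hu₀.le, one_div, Real.inv_rpow hu₀.le,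
      mul_assoc]
  simp only [enorm_eq_self]
  rw [hsplit, ENNReal.ofReal_mul (by positivity), mul_assoc, ENNReal.mul_rpow_of_nonneg _ _ hp.le,
    ← ENNReal.ofReal_rpow_of_pos (inv_pos.2 hu₀), ENNReal.rpow_inv_rpow hp.ne']

theorem logMeasure_Ioc {a d : ℝ} (ha : 0 < a) (hd : a ≤ d) :
    logMeasure (Ioc a d) = ENNReal.ofReal (Real.log (d / a)) := by
  have hint : IntegrableOn (fun u : ℝ => u⁻¹) (Ioc a d) :=
    (intervalIntegrable_inv_iff.2 (Or.inr (notMem_uIcc_of_lt ha (ha.trans_le hd)))).1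
  rw [logMeasure, withDensity_apply _ measurableSet_Ioc, ← ofReal_integral_eq_lintegral_ofReal hint
    (ae_restrict_of_forall_mem measurableSet_Ioc fun u hu => (inv_pos.2 (ha.trans hu.1)).le),
    ← intervalIntegral.integral_of_le hd, integral_inv_of_pos ha (ha.trans_le hd)]

theorem logMeasure_Ioo {a d : ℝ} (ha : 0 < a) (hd : a ≤ d) :
    logMeasure (Ioo a d) = ENNReal.ofReal (Real.log (d / a)) := by
  rw [← logMeasure_Ioc ha hd]
  exact measure_congr ((withDensity_absolutelyContinuous _ _).ae_le Ioo_ae_eq_Ioc)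

theorem lintegral_Ioc_rpow_logMeasure {η a : ℝ} (hη : 0 < η) (ha : 0 < a) :
    ∫⁻ u in Ioc 0 a, ENNReal.ofReal ((u / a) ^ η) ∂logMeasure = ENNReal.ofReal η⁻¹ := by
  have hlt : -1 < η - 1 := by linarith
  have hint := (intervalIntegral.intervalIntegrable_rpow' (a := 0) (b := a) hlt).1
  calc ∫⁻ u in Ioc 0 a, ENNReal.ofReal ((u / a) ^ η) ∂logMeasure
      = ∫⁻ u in Ioc 0 a, ENNReal.ofReal (a ^ (-η)) * ENNReal.ofReal (u ^ (η - 1)) := by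
        rw [setLIntegral_logMeasure measurableSet_Ioc]
        refine setLIntegral_congr_fun measurableSet_Ioc fun u hu => ?_
        have hu₀ : 0 < u := hu.1
        rw [← ENNReal.ofReal_mul (by positivity), ← ENNReal.ofReal_mul (by positivity),
          Real.div_rpow hu₀.le ha.le, Real.rpow_sub_one hu₀.ne', Real.rpow_neg ha.le]
        congr 1
        ring
    _ = ENNReal.ofReal (a ^ (-η)) * ENNReal.ofReal (a ^ η / η) := by
        rw [lintegral_const_mul _ (by fun_prop), ← ofReal_integral_eq_lintegral_ofReal hint
          (ae_restrict_of_forall_mem measurableSet_Ioc fun u hu => Real.rpow_nonneg hu.1.le _),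
          ← intervalIntegral.integral_of_le ha.le, integral_rpow (Or.inl hlt)]
        simp [Real.zero_rpow hη.ne']
    _ = ENNReal.ofReal η⁻¹ := by
        rw [← ENNReal.ofReal_mul (by positivity), Real.rpow_neg ha.le]
        congr 1
        field_simp

theorem lintegral_Ioi_rpow_neg_logMeasure {η d : ℝ} (hη : 0 < η) (hd : 0 < d) :
    ∫⁻ u in Ioi d, ENNReal.ofReal ((u / d) ^ (-η)) ∂logMeasure = ENNReal.ofReal η⁻¹ := by
  have hlt : -η - 1 < -1 := by linarith
  calc ∫⁻ u in Ioi d, ENNReal.ofReal ((u / d) ^ (-η)) ∂logMeasure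
      = ∫⁻ u in Ioi d, ENNReal.ofReal (d ^ η) * ENNReal.ofReal (u ^ (-η - 1)) := by
        rw [setLIntegral_logMeasure measurableSet_Ioi]
        refine setLIntegral_congr_fun measurableSet_Ioi fun u hu => ?_
        have hu₀ : 0 < u := hd.trans hu
        rw [← ENNReal.ofReal_mul (by positivity), ← ENNReal.ofReal_mul (by positivity),
          Real.div_rpow hu₀.le hd.le, Real.rpow_sub_one hu₀.ne', Real.rpow_neg hd.le,
          div_inv_eq_mul]
        congr 1
        ring
    _ = ENNReal.ofReal (d ^ η) * ENNReal.ofReal (d ^ (-η) / η) := by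
        rw [lintegral_const_mul _ (by fun_prop), ← ofReal_integral_eq_lintegral_ofReal
          (integrableOn_Ioi_rpow_of_lt hlt hd) (ae_restrict_of_forall_mem measurableSet_Ioi
            fun u hu => Real.rpow_nonneg (hd.trans hu).le _), integral_Ioi_rpow_of_lt hlt hd]
        simp [neg_div_neg_eq]
    _ = ENNReal.ofReal η⁻¹ := by
        rw [← ENNReal.ofReal_mul (by positivity), Real.rpow_neg hd.le]
        congr 1
        field_simp

theorem mul_logMeasure_rpow_le_weightedNorm {θ : ℝ} {q : ℝ≥0∞} (hq : q ≠ 0) {b : ℝ → ℝ}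
    {k : ℝ → ℝ≥0∞} {S : Set ℝ} (hS : MeasurableSet S) (hS₀ : S ⊆ Ioi 0) (hμS : logMeasure S ≠ 0)
    {m : ℝ≥0∞} (h : ∀ u ∈ S, m ≤ ENNReal.ofReal (u ^ (-θ) * b u) * k u) :
    m * logMeasure S ^ (1 / q.toReal) ≤ weightedNorm θ q b k S := by
  have hne : logMeasure.restrict S ≠ 0 := Measure.restrict_eq_zero.not.2 hμS
  rw [weightedNorm_eq_eLpNorm_logMeasure θ q b k hS hS₀, ← Measure.restrict_apply_univ S,
    ← enorm_eq_self m, ← eLpNorm_const m hq hne]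
  exact eLpNorm_mono_enorm_ae (ae_restrict_of_forall_mem hS h)

theorem ofReal_mul_log_rpow_le_weightedNorm {θ : ℝ} {q : ℝ≥0∞} (hq : q ≠ 0) {b φ : ℝ → ℝ}
    {a d r : ℝ} (ha : 0 < a) (hd : a ≤ d) (hlog : 0 < Real.log (d / a))
    (hφ : ∀ u ∈ Ioo a d, 0 ≤ φ u) (h : ∀ u ∈ Ioo a d, r ≤ u ^ (-θ) * b u * φ u) :
    ENNReal.ofReal (r * Real.log (d / a) ^ (1 / q.toReal)) ≤
      weightedNorm θ q b (ENNReal.ofReal ∘ φ) (Ioo a d) := by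
  rw [ENNReal.ofReal_mul' (by positivity), ← ENNReal.ofReal_rpow_of_pos hlog,
    ← logMeasure_Ioo ha hd]
  refine mul_logMeasure_rpow_le_weightedNorm hq measurableSet_Ioo (fun u hu => ha.trans hu.1)
    ?_ fun u hu => ?_
  · rw [logMeasure_Ioo ha hd]
    exact (ENNReal.ofReal_pos.2 hlog).ne'
  · rw [Function.comp_apply, ← ENNReal.ofReal_mul' (hφ u hu)]
    exact ENNReal.ofReal_le_ofReal (h u hu)

end LogMeasure

section Plateau

/-- The function equal to `1` on `[a, d]` that decays like the power `δ` of the relative distance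
outside. For `q > 0` its `L^q(du / u)` norm has the order of magnitude `log (d / a) ^ (1 / q)` when
`log (d / a) ≥ 1`. -/
noncomputable def plateau (a d δ u : ℝ) : ℝ :=
  min 1 (min ((u / a) ^ δ) ((u / d) ^ (-δ)))

variable {a d : ℝ}

theorem plateau_le_one (a d δ u : ℝ) : plateau a d δ u ≤ 1 :=
  min_le_left _ _

theorem plateau_pos (ha : 0 < a) (hd : 0 < d) {δ u : ℝ} (hu : 0 < u) : 0 < plateau a d δ u :=
  lt_min one_pos (lt_min (by positivity) (by positivity))

theorem plateau_rpow_le (ha : 0 < a) (hd : 0 < d) {δ p u : ℝ} (hp : 0 < p) (hu : 0 < u) :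
    plateau a d δ u ^ p ≤ plateau a d (δ * p) u := by
  have hnonneg : 0 ≤ plateau a d δ u := (plateau_pos ha hd hu).le
  rw [plateau.eq_1 a d (δ * p), ← neg_mul, Real.rpow_mul (by positivity),
    Real.rpow_mul (by positivity)]
  refine le_min (Real.rpow_le_one hnonneg (plateau_le_one ..) hp.le) (le_min ?_ ?_) <;>
    refine Real.rpow_le_rpow hnonneg ?_ hp.le
  · exact (min_le_right _ _).trans (min_le_left _ _)
  · exact (min_le_right _ _).trans (min_le_right _ _)

theorem lintegral_plateau_le {η : ℝ} (hη : 0 < η) (ha : 0 < a) (hd : a ≤ d) :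
    ∫⁻ u in Ioi 0, ENNReal.ofReal (plateau a d η u) ∂logMeasure ≤
      ENNReal.ofReal η⁻¹ + (ENNReal.ofReal (Real.log (d / a)) + ENNReal.ofReal η⁻¹) := by
  rw [← Ioc_union_Ioi_eq_Ioi ha.le, ← Ioc_union_Ioi_eq_Ioi hd]
  refine (lintegral_union_le _ _ _).trans (add_le_add ?_
    ((lintegral_union_le _ _ _).trans (add_le_add ?_ ?_)))
  · rw [← lintegral_Ioc_rpow_logMeasure hη ha]
    exact lintegral_mono fun u =>
      ENNReal.ofReal_le_ofReal ((min_le_right _ _).trans (min_le_left _ _))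
  · rw [← logMeasure_Ioc ha hd, ← setLIntegral_one]
    exact lintegral_mono fun u => ENNReal.ofReal_le_one.2 (plateau_le_one ..)
  · rw [← lintegral_Ioi_rpow_neg_logMeasure hη (ha.trans_le hd)]
    exact lintegral_mono fun u =>
      ENNReal.ofReal_le_ofReal ((min_le_right _ _).trans (min_le_right _ _))

theorem exists_eLpNorm_plateau_le {δ : ℝ} (hδ : 0 < δ) (q : ℝ≥0∞) :
    ∃ C : ℝ≥0, ∀ a d, 0 < a → a ≤ d → 1 ≤ Real.log (d / a) →
      eLpNorm (fun u => ENNReal.ofReal (plateau a d δ u)) q (logMeasure.restrict (Ioi 0)) ≤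
        C * ENNReal.ofReal (Real.log (d / a)) ^ (1 / q.toReal) := by
  rcases eq_or_ne q 0 with rfl | hq
  · exact ⟨0, by simp⟩
  rcases eq_or_ne q ∞ with rfl | hq'
  · refine ⟨1, fun a d _ _ _ => ?_⟩
    simp only [eLpNorm_exponent_top, ENNReal.toReal_top, div_zero, ENNReal.rpow_zero]
    refine eLpNormEssSup_le_of_ae_enorm_bound (Filter.Eventually.of_forall fun u => ?_)
    simpa using plateau_le_one ..
  have hp : 0 < q.toReal := ENNReal.toReal_pos hq hq'
  have hη : 0 < δ * q.toReal := mul_pos hδ hp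
  refine ⟨(2 * (δ * q.toReal)⁻¹ + 1).toNNReal ^ (1 / q.toReal), fun a d ha hd hlog => ?_⟩
  rw [eLpNorm_eq_lintegral_rpow_enorm_toReal hq hq',
    ENNReal.coe_rpow_of_nonneg _ (by positivity), ← ENNReal.mul_rpow_of_nonneg _ _ (by positivity)]
  gcongr
  calc ∫⁻ u in Ioi 0, ‖ENNReal.ofReal (plateau a d δ u)‖ₑ ^ q.toReal ∂logMeasure
      ≤ ∫⁻ u in Ioi 0, ENNReal.ofReal (plateau a d (δ * q.toReal) u) ∂logMeasure := by
        refine setLIntegral_mono' measurableSet_Ioi fun u hu => ?_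
        have hu₀ : 0 < u := hu
        rw [enorm_eq_self, ENNReal.ofReal_rpow_of_pos (plateau_pos ha (ha.trans_le hd) hu₀)]
        exact ENNReal.ofReal_le_ofReal (plateau_rpow_le ha (ha.trans_le hd) hp hu₀)
    _ ≤ _ := lintegral_plateau_le hη ha hd
    _ ≤ ENNReal.ofReal (2 * (δ * q.toReal)⁻¹ + 1) * ENNReal.ofReal (Real.log (d / a)) := by
        rw [← ENNReal.ofReal_add (by positivity) (by positivity),
          ← ENNReal.ofReal_add (by positivity) (by positivity),
          ← ENNReal.ofReal_mul (by positivity)]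
        refine ENNReal.ofReal_le_ofReal ?_
        nlinarith [inv_pos.2 hη]

end Plateau

section SlowVariation

theorem Approx.exists_le_mul {F G : ℝ → ℝ} (h : Approx F G) :
    ∃ C : ℝ, 0 < C ∧ ∀ s u, 0 < s → 0 < u → G s ≤ G u → F s ≤ C * F u := by
  obtain ⟨c, hc, C, hC, hFG⟩ := h
  refine ⟨C / c, div_pos hC hc, fun s u hs hu hGG => ?_⟩
  calc F s ≤ C * G s := (hFG s hs).2
    _ ≤ C * G u := by gcongr
    _ = C / c * (c * G u) := by field_simp
    _ ≤ C / c * F u := by gcongr; exact (hFG u hu).1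

theorem Approx.div {F G F' G' : ℝ → ℝ} (h : Approx F G) (h' : Approx F' G')
    (hG : ∀ t, 0 < t → 0 < G t) (hG' : ∀ t, 0 < t → 0 < G' t) :
    Approx (fun t => F t / F' t) (fun t => G t / G' t) := by
  obtain ⟨c, hc, C, hC, hFG⟩ := h
  obtain ⟨c', hc', C', hC', hFG'⟩ := h'
  refine ⟨c / C', div_pos hc hC', C / c', div_pos hC hc', fun t ht => ?_⟩
  have hGt := hG t ht
  have hG't := hG' t ht
  have hF't : 0 < F' t := (mul_pos hc' hG't).trans_le (hFG' t ht).1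
  have hFt : 0 < F t := (mul_pos hc hGt).trans_le (hFG t ht).1
  rw [div_mul_div_comm, div_mul_div_comm]
  exact ⟨div_le_div₀ hFt.le (hFG t ht).1 hF't (hFG' t ht).2,
    div_le_div₀ (by positivity) (hFG t ht).2 (by positivity) (hFG' t ht).1⟩

theorem Approx.congr_left {F F' G : ℝ → ℝ} (h : Approx F G) (hF : ∀ t, 0 < t → F' t = F t) :
    Approx F' G := by
  obtain ⟨c, hc, C, hC, hFG⟩ := h
  exact ⟨c, hc, C, hC, fun t ht => hF t ht ▸ hFG t ht⟩

variable {b b' : ℝ → ℝ}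

theorem SlowlyVarying.div (hb : SlowlyVarying b) (hb' : SlowlyVarying b') :
    SlowlyVarying (fun t => b t / b' t) where
  aemeasurable := hb.aemeasurable.div hb'.aemeasurable
  pos t ht := div_pos (hb.pos t ht) (hb'.pos t ht)
  exists_monotone ε hε := by
    obtain ⟨g, hg_pos, hg, hbg⟩ := hb.exists_monotone (ε / 2) (half_pos hε)
    obtain ⟨g', hg'_pos, hg', hbg'⟩ := hb'.exists_antitone (ε / 2) (half_pos hε)
    refine ⟨fun t => g t / g' t, fun t ht => div_pos (hg_pos t ht) (hg'_pos t ht),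
      fun s hs t ht hst => div_le_div₀ (hg_pos t ht).le (hg hs ht hst) (hg'_pos t ht)
        (hg' hs ht hst), (hbg.div hbg' hg_pos hg'_pos).congr_left fun t ht => ?_⟩
    rw [mul_div_mul_comm, ← Real.rpow_sub ht, sub_neg_eq_add, add_halves]
  exists_antitone ε hε := by
    obtain ⟨g, hg_pos, hg, hbg⟩ := hb.exists_antitone (ε / 2) (half_pos hε)
    obtain ⟨g', hg'_pos, hg', hbg'⟩ := hb'.exists_monotone (ε / 2) (half_pos hε)
    refine ⟨fun t => g t / g' t, fun t ht => div_pos (hg_pos t ht) (hg'_pos t ht),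
      fun s hs t ht hst => div_le_div₀ (hg_pos s hs).le (hg hs ht hst) (hg'_pos s hs)
        (hg' hs ht hst), (hbg.div hbg' hg_pos hg'_pos).congr_left fun t ht => ?_⟩
    rw [mul_div_mul_comm, ← Real.rpow_sub ht, ← neg_add', add_halves]

theorem SlowlyVarying.exists_potter_bound (hb : SlowlyVarying b) {ε : ℝ} (hε : 0 < ε) :
    ∃ C : ℝ, 0 < C ∧ ∀ s u, 0 < s → 0 < u →
      b u ≤ C * max ((u / s) ^ ε) ((u / s) ^ (-ε)) * b s := by
  obtain ⟨g, -, hg, hbg⟩ := hb.exists_monotone ε hε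
  obtain ⟨g', -, hg', hbg'⟩ := hb.exists_antitone ε hε
  obtain ⟨C, hC, h⟩ := hbg.exists_le_mul
  obtain ⟨C', -, h'⟩ := hbg'.exists_le_mul
  have le_of_rpow_mul_le {s u e D : ℝ} (hs : 0 < s) (hu : 0 < u)
      (hsu : u ^ (-e) * b u ≤ D * (s ^ (-e) * b s)) : b u ≤ D * (u / s) ^ e * b s := by
    rw [Real.rpow_neg hu.le, Real.rpow_neg hs.le, inv_mul_le_iff₀ (by positivity)] at hsu
    refine hsu.trans_eq ?_
    rw [Real.div_rpow hu.le hs.le]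
    ring
  refine ⟨max C C', lt_max_of_lt_left hC, fun s u hs hu => ?_⟩
  have hbs := hb.pos s hs
  rcases le_total s u with hsu | hus
  · refine (le_of_rpow_mul_le hs hu (h' u s hu hs (hg' hs hu hsu))).trans ?_
    gcongr
    exacts [le_max_right _ _, le_max_left _ _]
  · refine (le_of_rpow_mul_le hs hu (e := -ε) ?_).trans (b := C * (u / s) ^ (-ε) * b s) ?_
    · rw [neg_neg]
      exact h u s hu hs (hg hu hs hus)
    gcongr
    exacts [le_max_left _ _, le_max_right _ _]

theorem SlowlyVarying.not_geometric_growth (hb : SlowlyVarying b) {c r : ℝ} (hc : 1 < c)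
    (hr : 1 < r) : ¬ ∀ a, 0 < a → c * b a ≤ b (r * a) := by
  intro hgrowth
  have hsqrt : 1 < √c := Real.lt_sqrt_of_sq_lt (by simpa using hc)
  obtain ⟨C, -, hpotter⟩ := hb.exists_potter_bound (Real.logb_pos hr hsqrt)
  have hiter (n : ℕ) : c ^ n * b 1 ≤ b (r ^ n) := by
    induction n with
    | zero => simp
    | succ n ih =>
      calc c ^ (n + 1) * b 1 = c * (c ^ n * b 1) := by ring
        _ ≤ c * b (r ^ n) := by gcongr
        _ ≤ b (r ^ (n + 1)) := by rw [pow_succ']; exact hgrowth _ (by positivity)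
  have hrpow (n : ℕ) : (r ^ n) ^ Real.logb r √c = √c ^ n := by
    rw [← Real.rpow_pow_comm (by positivity), Real.rpow_logb (by positivity) hr.ne' (by positivity)]
  have hbound (n : ℕ) : √c ^ n ≤ C := by
    have hle := (hiter n).trans (hpotter 1 (r ^ n) one_pos (by positivity))
    have hone : 1 ≤ √c ^ n := one_le_pow₀ hsqrt.le
    rw [div_one, Real.rpow_neg (by positivity), hrpow,
      max_eq_left ((inv_le_one_of_one_le₀ hone).trans hone)] at hle
    have hle' := le_of_mul_le_mul_right hle (hb.pos 1 one_pos)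
    refine le_of_mul_le_mul_right (le_of_eq_of_le ?_ hle') (one_pos.trans_le hone)
    rw [← mul_pow, Real.mul_self_sqrt (zero_le_one.trans hc.le)]
  obtain ⟨n, hn⟩ := pow_unbounded_of_one_lt C hsqrt
  exact (hbound n).not_gt hn

/-- The multiple of `min 1 (u / s)`, the basic quasi-concave function with a corner at `s`, for
which `u ^ (-θ) * b u * tent θ b s u` has the value `1` at `u = s`. -/
noncomputable def tent (θ : ℝ) (b : ℝ → ℝ) (s u : ℝ) : ℝ :=
  s ^ θ / b s * min 1 (u / s)

theorem quasiConcave_tent {θ s : ℝ} (hs : 0 < s) (hbs : 0 < b s) : QuasiConcave (tent θ b s) :=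
  (quasiConcave_min_one_div hs).const_mul (div_pos (Real.rpow_pos_of_pos hs θ) hbs)

theorem rpow_neg_mul_min_mul_max_le {θ δ x : ℝ} (hδ₀ : 2 * δ ≤ θ) (hδ₁ : 2 * δ ≤ 1 - θ)
    (hδ : 0 ≤ δ) (hx : 0 < x) :
    x ^ (-θ) * min 1 x * max (x ^ δ) (x ^ (-δ)) ≤ min (x ^ δ) (x ^ (-δ)) := by
  rcases le_total 1 x with h1x | hx1
  · have hle : x ^ (-δ) ≤ x ^ δ := Real.rpow_le_rpow_of_exponent_le h1x (by linarith)
    rw [min_eq_left h1x, max_eq_left hle, min_eq_right hle, mul_one, ← Real.rpow_add hx]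
    exact Real.rpow_le_rpow_of_exponent_le h1x (by linarith)
  · have hle : x ^ δ ≤ x ^ (-δ) := Real.rpow_le_rpow_of_exponent_ge hx hx1 (by linarith)
    rw [min_eq_right hx1, max_eq_right hle, min_eq_left hle, ← Real.rpow_add_one hx.ne',
      ← Real.rpow_add hx]
    exact Real.rpow_le_rpow_of_exponent_ge hx hx1 (by linarith)

theorem min_rpow_le_plateau {a d s u δ : ℝ} (ha : 0 < a) (has : a ≤ s) (hsd : s ≤ d) (hu : 0 < u)
    (hδ : 0 ≤ δ) : min ((u / s) ^ δ) ((u / s) ^ (-δ)) ≤ plateau a d δ u := by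
  have hs : 0 < s := ha.trans_le has
  have hd : 0 < d := hs.trans_le hsd
  refine le_min ?_ (min_le_min ?_ ?_)
  · rcases le_total (u / s) 1 with h | h
    · exact min_le_of_left_le (Real.rpow_le_one (by positivity) h hδ)
    · exact min_le_of_right_le (Real.rpow_le_one_of_one_le_of_nonpos h (neg_nonpos.2 hδ))
  · gcongr
  · exact Real.rpow_le_rpow_of_nonpos (by positivity) (by gcongr) (neg_nonpos.2 hδ)

theorem SlowlyVarying.exists_tent_le_plateau (hb : SlowlyVarying b) {θ : ℝ} (hθ₀ : 0 < θ)
    (hθ₁ : θ < 1) :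
    ∃ δ > 0, ∃ D > 0, ∀ a d s u, 0 < a → a ≤ s → s ≤ d → 0 < u →
      u ^ (-θ) * b u * tent θ b s u ≤ D * plateau a d δ u := by
  obtain ⟨δ, hδ, hδ₀, hδ₁⟩ : ∃ δ > 0, 2 * δ ≤ θ ∧ 2 * δ ≤ 1 - θ :=
    ⟨min θ (1 - θ) / 2, half_pos (lt_min hθ₀ (sub_pos.2 hθ₁)),
      by linarith [min_le_left θ (1 - θ)], by linarith [min_le_right θ (1 - θ)]⟩
  obtain ⟨D, hD, hpotter⟩ := hb.exists_potter_bound hδ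
  refine ⟨δ, hδ, D, hD, fun a d s u ha has hsd hu => ?_⟩
  have hs : 0 < s := ha.trans_le has
  have hbs := hb.pos s hs
  calc u ^ (-θ) * b u * tent θ b s u = (u / s) ^ (-θ) * min 1 (u / s) * (b u / b s) := by
        rw [tent, Real.div_rpow hu.le hs.le, Real.rpow_neg hs.le, div_inv_eq_mul]
        ring
    _ ≤ (u / s) ^ (-θ) * min 1 (u / s) * (D * max ((u / s) ^ δ) ((u / s) ^ (-δ))) := by
        gcongr
        exact (div_le_iff₀ hbs).2 (hpotter s u hs hu)
    _ = D * ((u / s) ^ (-θ) * min 1 (u / s) * max ((u / s) ^ δ) ((u / s) ^ (-δ))) := by ring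
    _ ≤ D * min ((u / s) ^ δ) ((u / s) ^ (-δ)) := by
        gcongr
        exact rpow_neg_mul_min_mul_max_le hδ₀ hδ₁ hδ.le (div_pos hu hs)
    _ ≤ D * plateau a d δ u := by
        gcongr
        exact min_rpow_le_plateau ha has hsd hu hδ.le

theorem SlowlyVarying.exists_quasiConcave_le_plateau (hb : SlowlyVarying b) {θ : ℝ} (hθ₀ : 0 < θ)
    (hθ₁ : θ < 1) :
    ∃ δ > 0, ∃ D > 0, ∀ a d, 0 < a → a ≤ d → ∃ φ, QuasiConcave φ ∧
      (∀ u ∈ Icc a d, 1 ≤ u ^ (-θ) * b u * φ u) ∧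
      ∀ u, 0 < u → u ^ (-θ) * b u * φ u ≤ D * plateau a d δ u := by
  obtain ⟨δ, hδ, D, hD, htent⟩ := hb.exists_tent_le_plateau hθ₀ hθ₁
  refine ⟨δ, hδ, D, hD, fun a d ha hd => ?_⟩
  have hweight (u : ℝ) (hu : 0 < u) : 0 < u ^ (-θ) * b u :=
    mul_pos (Real.rpow_pos_of_pos hu _) (hb.pos u hu)
  have hle (u : ℝ) (hu : 0 < u) (s : Icc a d) :
      tent θ b s u ≤ D * plateau a d δ u / (u ^ (-θ) * b u) :=
    (le_div_iff₀' (hweight u hu)).2 (htent a d s u ha s.2.1 s.2.2 hu)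
  have hbdd (u : ℝ) (hu : 0 < u) : BddAbove (range fun s : Icc a d => tent θ b s u) :=
    ⟨_, forall_mem_range.2 (hle u hu)⟩
  have : Nonempty (Icc a d) := ⟨⟨a, le_rfl, hd⟩⟩
  refine ⟨fun u => ⨆ s : Icc a d, tent θ b s u, .iSup (fun s => ?_) hbdd, fun u hu => ?_,
    fun u hu => ?_⟩
  · have hs : 0 < (s : ℝ) := ha.trans_le s.2.1
    exact quasiConcave_tent hs (hb.pos s hs)
  · have hu₀ : 0 < u := ha.trans_le hu.1
    have hbu := hb.pos u hu₀
    calc 1 = u ^ (-θ) * b u * tent θ b u u := by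
          rw [tent, div_self hu₀.ne', min_self, mul_one, mul_div_assoc', mul_right_comm,
            ← Real.rpow_add hu₀]
          simp [hbu.ne']
      _ ≤ _ := mul_le_mul_of_nonneg_left (le_ciSup (hbdd u hu₀) ⟨u, hu⟩) (hweight u hu₀).le
  · exact (le_div_iff₀' (hweight u hu)).1 (ciSup_le (hle u hu))

theorem SlowlyVarying.exists_quasiConcave_weightedNorm_le (hb : SlowlyVarying b) {θ : ℝ}
    (hθ₀ : 0 < θ) (hθ₁ : θ < 1) (q : ℝ≥0∞) :
    ∃ D : ℝ≥0, ∀ a d, 0 < a → a ≤ d → 1 ≤ Real.log (d / a) → ∃ φ, QuasiConcave φ ∧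
      (∀ u ∈ Icc a d, 1 ≤ u ^ (-θ) * b u * φ u) ∧
      weightedNorm θ q b (ENNReal.ofReal ∘ φ) (Ioi 0) ≤
        D * ENNReal.ofReal (Real.log (d / a)) ^ (1 / q.toReal) := by
  obtain ⟨δ, hδ, D, hD, hplateau⟩ := hb.exists_quasiConcave_le_plateau hθ₀ hθ₁
  obtain ⟨C, hC⟩ := exists_eLpNorm_plateau_le hδ q
  refine ⟨D.toNNReal * C, fun a d ha hd hlog => ?_⟩
  obtain ⟨φ, hφ, hge, hle⟩ := hplateau a d ha hd
  refine ⟨φ, hφ, hge, ?_⟩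
  rw [weightedNorm_eq_eLpNorm_logMeasure _ _ _ _ measurableSet_Ioi Subset.rfl, ENNReal.coe_mul,
    mul_assoc]
  refine (eLpNorm_le_nnreal_smul_eLpNorm_of_ae_le_mul' (ae_restrict_of_forall_mem
    measurableSet_Ioi fun u hu => ?_) q).trans (mul_le_mul_right (hC a d ha hd hlog) _)
  have hu₀ : 0 < u := hu
  have hbu := hb.pos u hu₀
  simp only [enorm_eq_self, Function.comp_apply]
  rw [← ENNReal.ofReal_mul (by positivity)]
  exact (ENNReal.ofReal_le_ofReal (hle u hu₀)).trans_eq (ENNReal.ofReal_mul hD.le)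

theorem SlowlyVarying.exists_mul_log_rpow_le (hb : SlowlyVarying b) {θ : ℝ} (hθ₀ : 0 < θ)
    (hθ₁ : θ < 1) (q : ℝ≥0∞) {q' : ℝ≥0∞} (hq' : q' ≠ 0) (hb' : ∀ u, 0 < u → 0 < b' u) (C : ℝ≥0) :
    ∃ M > 0, ∀ S v, 0 ≤ v → (∀ φ, QuasiConcave φ →
        ENNReal.ofReal v * weightedNorm θ q' b' (ENNReal.ofReal ∘ φ) S ≤
          C * weightedNorm θ q b (ENNReal.ofReal ∘ φ) (Ioi 0)) →
      ∀ a d r, 0 < a → a ≤ d → 1 ≤ Real.log (d / a) → Ioo a d ⊆ S →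
        (∀ u ∈ Ioo a d, r ≤ b' u / b u) →
        v * (r * Real.log (d / a) ^ (1 / q'.toReal)) ≤
          M * Real.log (d / a) ^ (1 / q.toReal) := by
  obtain ⟨D, hD⟩ := hb.exists_quasiConcave_weightedNorm_le hθ₀ hθ₁ q
  refine ⟨C * D + 1, by positivity, fun S v hv hS a d r ha hd hlog hsub hr => ?_⟩
  obtain ⟨φ, hφ, hge, hle⟩ := hD a d ha hd hlog
  have hlog₀ : 0 < Real.log (d / a) := one_pos.trans_le hlog
  have hlower : ENNReal.ofReal (r * Real.log (d / a) ^ (1 / q'.toReal)) ≤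
      weightedNorm θ q' b' (ENNReal.ofReal ∘ φ) S := by
    refine le_trans (ofReal_mul_log_rpow_le_weightedNorm hq' ha hd hlog₀
      (fun u hu => (hφ.pos u (ha.trans hu.1)).le) fun u hu => ?_) (weightedNorm_mono_set _ hsub)
    have hu₀ : 0 < u := ha.trans hu.1
    have hbu := hb.pos u hu₀
    have hb'u := hb' u hu₀
    calc r ≤ b' u / b u * 1 := by simpa using hr u hu
      _ ≤ b' u / b u * (u ^ (-θ) * b u * φ u) := by gcongr; exact hge u (Ioo_subset_Icc_self hu)
      _ = u ^ (-θ) * b' u * φ u := by field_simp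
  have hmul := (mul_le_mul_right hlower (ENNReal.ofReal v)).trans
    ((hS φ hφ).trans (mul_le_mul_right hle C))
  rw [ENNReal.ofReal_rpow_of_pos hlog₀, ← mul_assoc (C : ℝ≥0∞), ← ENNReal.coe_mul,
    ← ENNReal.ofReal_coe_nnreal, ← ENNReal.ofReal_mul hv, ← ENNReal.ofReal_mul (by positivity),
    ENNReal.ofReal_le_ofReal_iff (by positivity), NNReal.coe_mul] at hmul
  refine hmul.trans (mul_le_mul_of_nonneg_right ?_ (by positivity))
  exact le_add_of_nonneg_right zero_le_one

end SlowVariation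

section WindowBounds

/-- The comparison of a function `w` with a function `ρ` that results from testing weighted
embeddings on the windows `(a, d)` on one side of `t`; the loss is a power of the logarithmic length
`log (d / a)` of the window. -/
structure WindowBounds (ρ w : ℝ → ℝ) (γ M : ℝ) : Prop where
  mul_le_of_le : ∀ t a d r, 0 < t → t ≤ a → a ≤ d → 1 ≤ Real.log (d / a) →
    (∀ u ∈ Ioo a d, ρ u ≤ r) → w t * Real.log (d / a) ^ γ ≤ M * r
  le_mul_of_ge : ∀ t a d r, 0 < a → a ≤ d → d ≤ t → 1 ≤ Real.log (d / a) →
    (∀ u ∈ Ioo a d, r ≤ ρ u) → r ≤ M * (w t * Real.log (d / a) ^ γ)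

variable {ρ w : ℝ → ℝ} {γ M : ℝ}

theorem SlowlyVarying.exists_le_mul_of_le_mul (hρ : SlowlyVarying ρ) (r : ℝ) :
    ∃ P > 0, ∀ s u, 0 < s → s ≤ u → u ≤ r * s → ρ u ≤ P * ρ s := by
  obtain ⟨C, hC, hpotter⟩ := hρ.exists_potter_bound one_pos
  refine ⟨C * max 1 r, by positivity, fun s u hs hsu hus => ?_⟩
  have hu : 0 < u := hs.trans_le hsu
  have hρs := hρ.pos s hs
  refine (hpotter s u hs hu).trans ?_
  rw [Real.rpow_one, Real.rpow_neg_one, inv_div, max_comm]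
  gcongr
  exacts [(div_le_one hu).2 hsu, (div_le_iff₀ hs).2 hus]

theorem WindowBounds.exists_comparison (h : WindowBounds ρ w γ M) (hM : 0 < M)
    (hρ : SlowlyVarying ρ) :
    ∃ A > 0, (∀ t s, 0 < t → t ≤ s → w t ≤ A * ρ s) ∧ ∀ s t, 0 < s → s ≤ t → ρ s ≤ A * w t := by
  have he : (1 : ℝ) ≤ Real.exp 1 := Real.one_le_exp zero_le_one
  obtain ⟨P, hP, hρP⟩ := hρ.exists_le_mul_of_le_mul (Real.exp 1)
  refine ⟨M * P, by positivity, fun t s ht hts => ?_, fun s t hs hst => ?_⟩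
  · have hs : 0 < s := ht.trans_le hts
    have hlog : Real.log (Real.exp 1 * s / s) = 1 := by
      rw [mul_div_cancel_right₀ _ hs.ne', Real.log_exp]
    have := h.mul_le_of_le t s (Real.exp 1 * s) (P * ρ s) ht hts (le_mul_of_one_le_left hs.le he)
      hlog.ge fun u hu => hρP s u hs hu.1.le hu.2.le
    rwa [hlog, Real.one_rpow, mul_one, ← mul_assoc] at this
  · have hse : 0 < s / Real.exp 1 := by positivity
    have hlog : Real.log (s / (s / Real.exp 1)) = 1 := by
      rw [div_div_cancel₀ hs.ne', Real.log_exp]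
    have := h.le_mul_of_ge t (s / Real.exp 1) s (ρ s / P) hse (div_le_self hs.le he) hst hlog.ge
      fun u hu => (div_le_iff₀' hP).2 (hρP u s (hse.trans hu.1) hu.2.le
        ((div_le_iff₀' (by positivity)).1 hu.1.le))
    rw [hlog, Real.one_rpow, mul_one, div_le_iff₀ hP] at this
    linarith

theorem WindowBounds.exists_growth (h : WindowBounds ρ w γ M) (hM : 0 < M)
    (hρ : SlowlyVarying ρ) :
    ∃ B > 0, ∀ a d, 0 < a → a ≤ d → 1 ≤ Real.log (d / a) →
      ρ a * Real.log (d / a) ^ |γ| ≤ B * ρ d := by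
  obtain ⟨A, hA, hwρ, hρw⟩ := h.exists_comparison hM hρ
  have hρρ (s u : ℝ) (hs : 0 < s) (hsu : s ≤ u) : ρ s ≤ A * (A * ρ u) :=
    (hρw s s hs le_rfl).trans (mul_le_mul_of_nonneg_left (hwρ s u hs hsu) hA.le)
  refine ⟨M * A ^ 3, by positivity, fun a d ha hd hlog => ?_⟩
  have hlog₀ : 0 < Real.log (d / a) := one_pos.trans_le hlog
  have hpow : 0 < Real.log (d / a) ^ γ := Real.rpow_pos_of_pos hlog₀ γ
  rcases le_total 0 γ with hγ | hγ
  · have hw := h.mul_le_of_le a a d (A * (A * ρ d)) ha le_rfl hd hlog fun u hu =>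
      hρρ u d (ha.trans hu.1) hu.2.le
    rw [abs_of_nonneg hγ]
    calc ρ a * Real.log (d / a) ^ γ ≤ A * w a * Real.log (d / a) ^ γ := by
          gcongr; exact hρw a a ha le_rfl
      _ = A * (w a * Real.log (d / a) ^ γ) := mul_assoc _ _ _
      _ ≤ A * (M * (A * (A * ρ d))) := by gcongr
      _ = M * A ^ 3 * ρ d := by ring
  · have hw := h.le_mul_of_ge d a d (ρ a / A ^ 2) ha hd le_rfl hlog fun u hu =>
      (div_le_iff₀' (by positivity)).2 ((hρρ a u ha hu.1.le).trans_eq (by ring))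
    rw [abs_of_nonpos hγ, Real.rpow_neg hlog₀.le, mul_inv_le_iff₀ hpow]
    calc ρ a ≤ A ^ 2 * (M * (w d * Real.log (d / a) ^ γ)) := (div_le_iff₀' (by positivity)).1 hw
      _ ≤ A ^ 2 * (M * (A * ρ d * Real.log (d / a) ^ γ)) := by
          gcongr; exact hwρ d d (ha.trans_le hd) le_rfl
      _ = M * A ^ 3 * ρ d * Real.log (d / a) ^ γ := by ring

theorem SlowlyVarying.not_windowBounds (hρ : SlowlyVarying ρ) (hγ : γ ≠ 0) (hM : 0 < M) :
    ¬ WindowBounds ρ w γ M := by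
  intro h
  obtain ⟨B, hB, hgrowth⟩ := h.exists_growth hM hρ
  obtain ⟨L, hLB, hL⟩ := (((tendsto_rpow_atTop (abs_pos.2 hγ)).eventually_ge_atTop (2 * B)).and
    (Filter.eventually_ge_atTop 1)).exists
  have hexp : 1 < Real.exp L := Real.one_lt_exp_iff.2 (one_pos.trans_le hL)
  refine hρ.not_geometric_growth one_lt_two hexp fun a ha => ?_
  have hlog : Real.log (Real.exp L * a / a) = L := by
    rw [mul_div_cancel_right₀ _ ha.ne', Real.log_exp]
  have hle := hgrowth a (Real.exp L * a) ha (le_mul_of_one_le_left ha.le hexp.le) (hlog.symm ▸ hL)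
  rw [hlog] at hle
  have hρa := hρ.pos a ha
  have : ρ a * (2 * B) ≤ ρ a * L ^ |γ| := by gcongr
  refine le_of_mul_le_mul_left (a := B) ?_ hB
  linarith

end WindowBounds

section Couple

theorem K_le_left {V : Type*} [AddCommGroup V] {N₀ N₁ : V → ℝ≥0∞} (h : N₁ 0 = 0) (t : ℝ) (f : V) :
    K N₀ N₁ t f ≤ N₀ f :=
  (iInf_le_of_le f (iInf₂_le_of_le 0 (add_zero f).symm le_rfl)).trans (by simp [h])

theorem K_le_right {V : Type*} [AddCommGroup V] {N₀ N₁ : V → ℝ≥0∞} (h : N₀ 0 = 0) (t : ℝ) (f : V) :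
    K N₀ N₁ t f ≤ ENNReal.ofReal t * N₁ f :=
  (iInf_le_of_le 0 (iInf₂_le_of_le f (zero_add f).symm le_rfl)).trans (by simp [h])

variable {𝕜 V : Type*} [RCLike 𝕜] [AddCommGroup V] [Module 𝕜 V] [TopologicalSpace V]

theorem QuasiNormedSubspace.extNorm_zero (A : QuasiNormedSubspace 𝕜 V) : A.extNorm 0 = 0 := by
  have h : A.qnorm ⟨0, A.carrier.zero_mem⟩ = 0 := (A.qnorm_eq_zero_iff _).2 rfl
  simp [QuasiNormedSubspace.extNorm, h]

theorem coupleK_zero (A₀ A₁ : QuasiNormedSubspace 𝕜 V) (t : ℝ) : coupleK A₀ A₁ t 0 = 0 :=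
  nonpos_iff_eq_zero.1 ((K_le_left A₁.extNorm_zero t 0).trans A₀.extNorm_zero.le)

theorem interpNorm_zero (A₀ A₁ : QuasiNormedSubspace 𝕜 V) (θ : ℝ) (q : ℝ≥0∞) (b : ℝ → ℝ) :
    interpNorm A₀ A₁ θ q b 0 = 0 := by
  simp [interpNorm, weightedNorm, coupleK_zero]

variable {A₀ A₁ : QuasiNormedSubspace 𝕜 V} {θ : ℝ}

theorem KSurjective.exists_forall_quasiConcave_le (hA : KSurjective A₀ A₁) {q : ℝ≥0∞}
    (hq : q ≠ 0) {b : ℝ → ℝ} (hb : AEMeasurable b (volume.restrict (Ioi 0)))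
    (hb_pos : ∀ u, 0 < u → 0 < b u) {ι : Type*} {T : ι → (ℝ → ℝ≥0∞) → ℝ≥0∞}
    (hT : ∀ i, MonotoneHomogeneous (T i)) {C : ℝ≥0}
    (hC : ∀ f ∈ A₀.carrier ⊔ A₁.carrier, ∀ i,
      T i (fun u => coupleK A₀ A₁ u f) ≤ C * interpNorm A₀ A₁ θ q b f) :
    ∃ C : ℝ≥0, ∀ φ, QuasiConcave φ → ∀ i,
      T i (ENNReal.ofReal ∘ φ) ≤ C * weightedNorm θ q b (ENNReal.ofReal ∘ φ) (Ioi 0) := by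
  refine KInterpolation.exists_forall_quasiConcave_le hb hb_pos hq hT fun φ hφ hfin => ?_
  obtain ⟨f, hf, c, hc, c', hc', hcf⟩ := hA φ hφ
  have hφf (u : ℝ) (hu : 0 < u) :
      ENNReal.ofReal (φ u) ≤ c⁻¹.toNNReal * coupleK A₀ A₁ u f := by
    calc ENNReal.ofReal (φ u) = ENNReal.ofReal c⁻¹ * ENNReal.ofReal (c * φ u) := by
          rw [← ENNReal.ofReal_mul (inv_pos.2 hc).le, inv_mul_cancel_left₀ hc.ne']
      _ ≤ ENNReal.ofReal c⁻¹ * coupleK A₀ A₁ u f := by gcongr; exact (hcf u hu).1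
  have hfφ : interpNorm A₀ A₁ θ q b f ≤
      c'.toNNReal * weightedNorm θ q b (ENNReal.ofReal ∘ φ) (Ioi 0) :=
    weightedNorm_le_mul measurableSet_Ioi fun u hu =>
      (hcf u hu).2.trans_eq (ENNReal.ofReal_mul hc'.le)
  lift weightedNorm θ q b (ENNReal.ofReal ∘ φ) (Ioi 0) to ℝ≥0 using hfin.ne with N
  refine ⟨c⁻¹.toNNReal * (C * (c'.toNNReal * N)), fun i => (hT i hφf).trans ?_⟩
  push_cast
  gcongr
  exact (hC f hf i).trans (by gcongr)

variable {q₀ q₁ : ℝ≥0∞} {b₀ b₁ w : ℝ → ℝ}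

theorem KSurjective.exists_mul_log_rpow_le_of_embedding_Ioi (hA : KSurjective A₀ A₁)
    (hθ₀ : 0 < θ) (hθ₁ : θ < 1) (hq₀ : q₀ ≠ 0) (hq₁ : q₁ ≠ 0) (hb₀ : SlowlyVarying b₀)
    (hb₁ : ∀ u, 0 < u → 0 < b₁ u) (hw : ∀ t, 0 < t → 0 < w t) {C : ℝ≥0}
    (h : ∀ f ∈ A₀.carrier ⊔ A₁.carrier, ∀ t, 0 < t →
      ENNReal.ofReal (w t) * weightedNorm θ q₁ b₁ (fun u => coupleK A₀ A₁ u f) (Ioi t) ≤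
        C * interpNorm A₀ A₁ θ q₀ b₀ f) :
    ∃ M > 0, ∀ t a d r, 0 < t → t ≤ a → a ≤ d → 1 ≤ Real.log (d / a) →
      (∀ u ∈ Ioo a d, r ≤ b₁ u / b₀ u) →
      w t * (r * Real.log (d / a) ^ (1 / q₁.toReal)) ≤ M * Real.log (d / a) ^ (1 / q₀.toReal) := by
  obtain ⟨C', hC'⟩ := hA.exists_forall_quasiConcave_le hq₀ hb₀.aemeasurable hb₀.pos
    (fun t : Ioi (0 : ℝ) => (monotoneHomogeneous_weightedNorm θ q₁ b₁ measurableSet_Ioi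
      (Ioi_subset_Ioi t.2.le)).const_mul (ENNReal.ofReal (w t))) fun f hf t => h f hf t t.2
  obtain ⟨M, hM, hle⟩ := hb₀.exists_mul_log_rpow_le hθ₀ hθ₁ q₀ hq₁ hb₁ C'
  exact ⟨M, hM, fun t a d r ht hta hd hlog => hle (Ioi t) (w t) (hw t ht).le
    (fun φ hφ => hC' φ hφ ⟨t, ht⟩) a d r (ht.trans_le hta) hd hlog fun u hu => hta.trans_lt hu.1⟩

theorem KSurjective.exists_mul_log_rpow_le_of_embedding_Ioo (hA : KSurjective A₀ A₁)
    (hθ₀ : 0 < θ) (hθ₁ : θ < 1) (hq₀ : q₀ ≠ 0) (hq₁ : q₁ ≠ 0) (hb₀ : ∀ u, 0 < u → 0 < b₀ u)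
    (hb₁ : SlowlyVarying b₁) (hw : ∀ t, 0 < t → 0 < w t) {C : ℝ≥0}
    (h : ∀ f ∈ A₀.carrier ⊔ A₁.carrier, ∀ t, 0 < t →
      weightedNorm θ q₀ b₀ (fun u => coupleK A₀ A₁ u f) (Ioo 0 t) ≤
        C * (ENNReal.ofReal (w t) * interpNorm A₀ A₁ θ q₁ b₁ f)) :
    ∃ M : ℝ, ∀ t a d r, 0 < a → a ≤ d → d ≤ t → 1 ≤ Real.log (d / a) →
      (∀ u ∈ Ioo a d, r ≤ b₀ u / b₁ u) →
      r * Real.log (d / a) ^ (1 / q₀.toReal) ≤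
        M * (w t * Real.log (d / a) ^ (1 / q₁.toReal)) := by
  obtain ⟨C', hC'⟩ := hA.exists_forall_quasiConcave_le (θ := θ) (C := C) hq₁ hb₁.aemeasurable
    hb₁.pos (fun t : Ioi (0 : ℝ) => (monotoneHomogeneous_weightedNorm θ q₀ b₀
      (S := Ioo 0 (t : ℝ)) measurableSet_Ioo Ioo_subset_Ioi_self).const_mul
        (ENNReal.ofReal (w t)⁻¹)) fun f hf t => by
      rw [ENNReal.ofReal_inv_of_pos (hw t t.2), ENNReal.inv_mul_le_iff
        (ENNReal.ofReal_pos.2 (hw t t.2)).ne' ENNReal.ofReal_ne_top, mul_left_comm]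
      exact h f hf t t.2
  obtain ⟨M, -, hle⟩ := hb₁.exists_mul_log_rpow_le hθ₀ hθ₁ q₁ hq₀ hb₀ C'
  refine ⟨M, fun t a d r ha hd hdt hlog hr => ?_⟩
  have ht : 0 < t := (ha.trans_le hd).trans_le hdt
  have := hle (Ioo 0 t) (w t)⁻¹ (inv_pos.2 (hw t ht)).le (fun φ hφ => hC' φ hφ ⟨t, ht⟩) a d r ha hd
    hlog (Ioo_subset_Ioo ha.le hdt) hr
  rwa [inv_mul_le_iff₀ (hw t ht), mul_left_comm] at this

theorem KSurjective.exists_windowBounds (hA : KSurjective A₀ A₁) (hθ₀ : 0 < θ) (hθ₁ : θ < 1)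
    (hq₀ : q₀ ≠ 0) (hq₁ : q₁ ≠ 0) (hb₀ : SlowlyVarying b₀) (hb₁ : SlowlyVarying b₁)
    (hw : ∀ t, 0 < t → 0 < w t) {C : ℝ≥0}
    (hright : ∀ f ∈ A₀.carrier ⊔ A₁.carrier, ∀ t, 0 < t →
      ENNReal.ofReal (w t) * weightedNorm θ q₁ b₁ (fun u => coupleK A₀ A₁ u f) (Ioi t) ≤
        C * interpNorm A₀ A₁ θ q₀ b₀ f)
    (hleft : ∀ f ∈ A₀.carrier ⊔ A₁.carrier, ∀ t, 0 < t →
      weightedNorm θ q₀ b₀ (fun u => coupleK A₀ A₁ u f) (Ioo 0 t) ≤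
        C * (ENNReal.ofReal (w t) * interpNorm A₀ A₁ θ q₁ b₁ f)) :
    ∃ M > 0, WindowBounds (fun u => b₀ u / b₁ u) w (1 / q₁.toReal - 1 / q₀.toReal) M := by
  obtain ⟨M₀, hM₀, hle₀⟩ :=
    hA.exists_mul_log_rpow_le_of_embedding_Ioi hθ₀ hθ₁ hq₀ hq₁ hb₀ hb₁.pos hw hright
  obtain ⟨M₁, hle₁⟩ :=
    hA.exists_mul_log_rpow_le_of_embedding_Ioo hθ₀ hθ₁ hq₀ hq₁ hb₀.pos hb₁ hw hleft
  refine ⟨max M₀ M₁, lt_max_of_lt_left hM₀, fun t a d r ht hta hd hlog hr => ?_,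
    fun t a d r ha hd hdt hlog hr => ?_⟩
  · have hlog₀ : 0 < Real.log (d / a) := one_pos.trans_le hlog
    have ha : 0 < a := ht.trans_le hta
    have had : a < d := hd.lt_of_ne fun h => by simp [h, (ha.trans_le hd).ne'] at hlog₀
    have hρ (u : ℝ) (hu : u ∈ Ioo a d) : 0 < b₀ u / b₁ u :=
      (hb₀.div hb₁).pos u (ha.trans hu.1)
    have hr₀ : 0 < r := by
      obtain ⟨u, hu⟩ := nonempty_Ioo.2 had
      exact (hρ u hu).trans_le (hr u hu)
    have hle := hle₀ t a d r⁻¹ ht hta hd hlog fun u hu => by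
      rw [← inv_div]
      exact inv_anti₀ (hρ u hu) (hr u hu)
    rw [mul_left_comm, inv_mul_le_iff₀ hr₀] at hle
    rw [Real.rpow_sub hlog₀, mul_div_assoc', div_le_iff₀ (by positivity)]
    refine hle.trans ?_
    rw [mul_left_comm, mul_assoc]
    gcongr
    exact le_max_left _ _
  · have hlog₀ : 0 < Real.log (d / a) := one_pos.trans_le hlog
    have hwt := hw t ((ha.trans_le hd).trans_le hdt)
    rw [Real.rpow_sub hlog₀, mul_div_assoc', mul_div_assoc', le_div_iff₀ (by positivity)]
    refine (hle₁ t a d r ha hd hdt hlog hr).trans ?_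
    gcongr
    exact le_max_right _ _

theorem one_div_toReal_ne {q₀ q₁ : ℝ≥0∞} (hq₀ : q₀ ≠ 0) (hq₁ : q₁ ≠ 0) (hq : q₀ ≠ q₁) :
    1 / q₀.toReal ≠ 1 / q₁.toReal := by
  rw [one_div, one_div, ← ENNReal.toReal_inv, ← ENNReal.toReal_inv, Ne,
    ENNReal.toReal_eq_toReal_iff' (ENNReal.inv_ne_top.2 hq₀) (ENNReal.inv_ne_top.2 hq₁), inv_inj]
  exact hq

end Couple

end KInterpolation

theorem mainTheorem5 {𝕜 V : Type*} [RCLike 𝕜] [AddCommGroup V] [Module 𝕜 V]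
    [TopologicalSpace V] [IsTopologicalAddGroup V] [ContinuousSMul 𝕜 V] [T2Space V]
    (A₀ A₁ : KInterpolation.QuasiNormedSubspace 𝕜 V)
    (hA : KInterpolation.KSurjective A₀ A₁)
    (θ : ℝ) (hθ₀ : 0 < θ) (hθ₁ : θ < 1)
    (q₀ q₁ : ℝ≥0∞) (hq₀ : 0 < q₀) (hq₁ : 0 < q₁) (hq : q₀ ≠ q₁)
    (b₀ b₁ : ℝ → ℝ) (hb₀ : KInterpolation.SlowlyVarying b₀)
    (hb₁ : KInterpolation.SlowlyVarying b₁) :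
    ¬ ∃ w : ℝ → ℝ, (∀ t : ℝ, 0 < t → 0 < w t) ∧
      ∃ c : ℝ, 0 < c ∧ ∀ f ∈ A₀.carrier ⊔ A₁.carrier, ∀ t : ℝ, 0 < t →
        ENNReal.ofReal c *
            (KInterpolation.weightedNorm θ q₀ b₀
                (fun s => KInterpolation.coupleK A₀ A₁ s f) (Ioo 0 t) +
              ENNReal.ofReal (w t) *
                KInterpolation.weightedNorm θ q₁ b₁
                  (fun s => KInterpolation.coupleK A₀ A₁ s f) (Ioi t)) ≤
          KInterpolation.K (KInterpolation.interpNorm A₀ A₁ θ q₀ b₀)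
            (KInterpolation.interpNorm A₀ A₁ θ q₁ b₁) (w t) f := by
  rintro ⟨w, hw, c, hc, h⟩
  have hK_le (f : V) (hf : f ∈ A₀.carrier ⊔ A₁.carrier) (t : ℝ) (ht : 0 < t) :=
    (ENNReal.mul_le_iff_le_inv (ENNReal.ofReal_pos.2 hc).ne' ENNReal.ofReal_ne_top).1 (h f hf t ht)
  rw [ENNReal.ofReal, ← ENNReal.coe_inv (Real.toNNReal_pos.2 hc).ne'] at hK_le
  obtain ⟨M, hM, hbounds⟩ := hA.exists_windowBounds hθ₀ hθ₁ hq₀.ne' hq₁.ne' hb₀ hb₁ hw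
    (fun f hf t ht => le_add_self.trans ((hK_le f hf t ht).trans (mul_le_mul_right
      (KInterpolation.K_le_left (KInterpolation.interpNorm_zero A₀ A₁ θ q₁ b₁) (w t) f) _)))
    (fun f hf t ht => le_self_add.trans ((hK_le f hf t ht).trans (mul_le_mul_right
      (KInterpolation.K_le_right (KInterpolation.interpNorm_zero A₀ A₁ θ q₀ b₀) (w t) f) _)))
  exact (hb₀.div hb₁).not_windowBounds
    (sub_ne_zero.2 (KInterpolation.one_div_toReal_ne hq₁.ne' hq₀.ne' hq.symm)) hM hbounds
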